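/- Let $\Omega\subseteq\mathbb R^n$ be open and let $F=(f_{ij})$ be a smooth solution on $\Omega$ of the $U(n)/O(n)$-system: $F$ is a real symmetric $n\times n$ matrix with $f_{ii}=0$ and $$(f_{ij})_{x_i}+(f_{ij})_{x_j}+\sum_k f_{ik}f_{jk}=0\ (i\neq j),\qquad (f_{ij})_{x_k}=f_{ik}f_{kj}\ (i,j,k\text{ distinct}).$$ Put $\delta=\mathrm{diag}(dx_1,\dots,dx_n)$. Let $A=(a_{ij}):\Omega\to O(n)$ and $U:\Omega\to U(n)$ be smooth with $A^{-1}dA=[\delta,F]$ and $U^{-1}dU=i\,A\delta A^t$ (under $B+iC\mapsto\begin{pmatrix}B&-C\\C&B\end{pmatrix}$ the last form is $\begin{pmatrix}0&-A\delta A^t\\A\delta A^t&0\end{pmatrix}$). Fix $m\in\{1,\dots,n\}$, let $X:\Omega\to S^{2n-1}\subset\mathbb C^n$ be the $m$-th column of $U$, and let $O\subseteq\Omega$ be an open set on which $a_{m1},\dots,a_{mn}$ have no zeros. Let $M=X(O)$; these are the flat submanifolds of $S^{2n-1}$, Lagrangian in $\mathbb R^{2n}=\mathbb C^n$, that correspond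 to $F$. Let $\pi:S^{2n-1}\to\mathbb CP^{n-1}$ be the Hopf fibration, and give $\mathbb CP^{n-1}$ the Fubini–Study metric and its Kähler form. Write $\mathbf 1=(1,\dots,1)$ and call a set $S\subseteq\mathbb R^n$ saturated if $S+\mathbb R\mathbf 1=S$. Then: 1. (Invariance under the Hopf action.) If $x\in O$, $t\in\mathbb R$ and the segment from $x$ to $x+t\mathbf 1$ lies in $O$, then $X(x+t\mathbf 1)=e^{it}X(x)$. 2. If $O$ is saturated, then $M=\pi^{-1}(\pi(M))$. If $\Omega$ is saturated (for example $\Omega=\mathbb R^n$), then the largest possible choice $O=\{x\in\Omega: a_{mj}(x)\neq0\text{ for all }j\}$ is saturated. 3. $\pi(M)$ is an immersed flat Lagrangian submanifold of $\mathbb CP^{n-1}$: every point of $O$ has an open neighbourhood $W\subseteq O$ on which $\pi\circ X$ is a smooth submersion of $W$ onto an open set $V\subseteq\mathbb R^{n-1}$ followed by a smooth immersion $V\to\mathbb CP^{n-1}$ that pulls the Kähler form back to $0$ and induces a flat metric on $V$. If $O$ is saturated, one can take $W=O$. -/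

import Mathlib

open scoped Matrix ContDiff

/-- The `j`-th partial derivative of a map defined on (an open part of) `ℝᵏ`. -/
noncomputable def pderiv {k : ℕ} {G : Type*} [NormedAddCommGroup G] [NormedSpace ℝ G]
    (f : (Fin k → ℝ) → G) (j : Fin k) (x : Fin k → ℝ) : G :=
  fderiv ℝ f x (Pi.single j 1)

/-- The entrywise `k`-th partial derivative of a matrix-valued map. -/
noncomputable def matPderiv {n : ℕ} {𝕜 : Type*} [NormedField 𝕜] [NormedSpace ℝ 𝕜]
    (B : (Fin n → ℝ) → Matrix (Fin n) (Fin n) 𝕜) (k : Fin n) (x : Fin n → ℝ) :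
    Matrix (Fin n) (Fin n) 𝕜 :=
  Matrix.of fun i j => pderiv (fun y => B y i j) k x

/-- A matrix-valued map all of whose entries are smooth on `Ω`. -/
def MatSmoothOn {n : ℕ} {𝕜 : Type*} [NormedField 𝕜] [NormedSpace ℝ 𝕜]
    (B : (Fin n → ℝ) → Matrix (Fin n) (Fin n) 𝕜) (Ω : Set (Fin n → ℝ)) : Prop :=
  ∀ i j, ContDiffOn ℝ ∞ (fun x => B x i j) Ω

/-! ### The `U(n)/O(n)`-system and its frames -/

/-- `F` is a smooth solution on `Ω` of the `U(n)/O(n)`-system: `F = (f_ij)` is symmetric with zero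
diagonal, and
`∂_i f_ij + ∂_j f_ij + ∑_k f_ik f_jk = 0` for `i ≠ j`, `∂_k f_ij = f_ik f_kj` for distinct `i j k`. -/
structure IsUOSolution {n : ℕ} (F : (Fin n → ℝ) → Matrix (Fin n) (Fin n) ℝ)
    (Ω : Set (Fin n → ℝ)) : Prop where
  smooth : MatSmoothOn F Ω
  symm : ∀ x ∈ Ω, ∀ i j, F x i j = F x j i
  diag : ∀ x ∈ Ω, ∀ i, F x i i = 0
  eq_two : ∀ x ∈ Ω, ∀ i j, i ≠ j →
    pderiv (fun y => F y i j) i x + pderiv (fun y => F y i j) j x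
      + ∑ k, F x i k * F x j k = 0
  eq_three : ∀ x ∈ Ω, ∀ i j k, i ≠ j → j ≠ k → i ≠ k →
    pderiv (fun y => F y i j) k x = F x i k * F x k j

/-- The value `e_kk` on `∂/∂x_k` of the matrix of one-forms `δ = diag(dx_1, …, dx_n)`. -/
def deltaForm {n : ℕ} (k : Fin n) : Matrix (Fin n) (Fin n) ℝ := Matrix.single k k 1

/-- `A : Ω → O(n)` is smooth and `A⁻¹ dA = [δ, F]` on `Ω`. -/
def IsOrthogonalFrame {n : ℕ} (F : (Fin n → ℝ) → Matrix (Fin n) (Fin n) ℝ)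
    (A : (Fin n → ℝ) → Matrix.orthogonalGroup (Fin n) ℝ) (Ω : Set (Fin n → ℝ)) : Prop :=
  MatSmoothOn (fun x => (A x : Matrix (Fin n) (Fin n) ℝ)) Ω ∧
  ∀ x ∈ Ω, ∀ k,
    (((A x)⁻¹ : Matrix.orthogonalGroup (Fin n) ℝ) : Matrix (Fin n) (Fin n) ℝ)
        * matPderiv (fun y => (A y : Matrix (Fin n) (Fin n) ℝ)) k x
      = deltaForm k * F x - F x * deltaForm k

/-- `U : Ω → U(n)` is smooth and `U⁻¹ dU = i A δ Aᵗ` on `Ω`.  Under the embedding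
`B + iC ↦ [[B, -C], [C, B]]` of `U(n)` into `O(2n)` the right-hand side is
`[[0, -AδAᵗ], [AδAᵗ, 0]]`. -/
def IsUnitaryFrame {n : ℕ} (A : (Fin n → ℝ) → Matrix.orthogonalGroup (Fin n) ℝ)
    (U : (Fin n → ℝ) → Matrix.unitaryGroup (Fin n) ℂ) (Ω : Set (Fin n → ℝ)) : Prop :=
  MatSmoothOn (fun x => (U x : Matrix (Fin n) (Fin n) ℂ)) Ω ∧
  ∀ x ∈ Ω, ∀ k,
    (((U x)⁻¹ : Matrix.unitaryGroup (Fin n) ℂ) : Matrix (Fin n) (Fin n) ℂ)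
        * matPderiv (fun y => (U y : Matrix (Fin n) (Fin n) ℂ)) k x
      = Complex.I • ((A x : Matrix (Fin n) (Fin n) ℝ) * deltaForm k
          * (A x : Matrix (Fin n) (Fin n) ℝ)ᵀ).map Complex.ofReal

/-! ### The Hopf fibration -/

/-- The unit sphere `S^{2n-1}` of `ℂⁿ = ℝ²ⁿ`. -/
abbrev USphere (n : ℕ) : Type := Metric.sphere (0 : EuclideanSpace ℂ (Fin n)) 1

/-- Complex projective space `ℂP^{n-1}`, the space of complex lines of `ℂⁿ`. -/
abbrev CProj (n : ℕ) : Type := Projectivization ℂ (EuclideanSpace ℂ (Fin n))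

/-- The Hopf fibration `π : S^{2n-1} → ℂP^{n-1}`. -/
noncomputable def hopf {n : ℕ} (z : USphere n) : CProj n :=
  Projectivization.mk ℂ (z : EuclideanSpace ℂ (Fin n)) (ne_zero_of_mem_unit_sphere z)

theorem unitary_column_mem {n : ℕ} (u : Matrix.unitaryGroup (Fin n) ℂ) (m : Fin n) :
    (WithLp.toLp 2 (fun i => (u : Matrix (Fin n) (Fin n) ℂ) i m) : EuclideanSpace ℂ (Fin n))
      ∈ Metric.sphere (0 : EuclideanSpace ℂ (Fin n)) 1 := by
  have h : star (u : Matrix (Fin n) (Fin n) ℂ) * (u : Matrix (Fin n) (Fin n) ℂ) = 1 :=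
    Matrix.UnitaryGroup.star_mul_self u
  have h2 := congrFun (congrFun h m) m
  rw [Matrix.mul_apply, Matrix.one_apply_eq] at h2
  have h3 : ∑ i, ‖(u : Matrix (Fin n) (Fin n) ℂ) i m‖ ^ 2 = 1 := by
    have : ((∑ i, ‖(u : Matrix (Fin n) (Fin n) ℂ) i m‖ ^ 2 : ℝ) : ℂ) = 1 := by
      rw [← h2]
      push_cast
      refine Finset.sum_congr rfl fun i _ => ?_
      rw [Matrix.star_apply]
      exact (Complex.conj_mul' _).symm
    exact_mod_cast this
  rw [mem_sphere_zero_iff_norm, EuclideanSpace.norm_eq]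
  simp [h3]

/-- The `m`-th column of a `U(n)`-valued map, as a map into `S^{2n-1} ⊂ ℂⁿ`. -/
noncomputable def columnMap {n : ℕ} (U : (Fin n → ℝ) → Matrix.unitaryGroup (Fin n) ℂ) (m : Fin n)
    (x : Fin n → ℝ) : USphere n :=
  ⟨WithLp.toLp 2 (fun i => (U x : Matrix (Fin n) (Fin n) ℂ) i m), unitary_column_mem (U x) m⟩

/-! ### Curvature of a metric given in coordinates -/

/-- Christoffel symbols `Γ^l_{ij}` of the metric `∑ g_ij dx_i dx_j`. -/
noncomputable def christoffel {k : ℕ} (g : (Fin k → ℝ) → Matrix (Fin k) (Fin k) ℝ)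
    (l i j : Fin k) (x : Fin k → ℝ) : ℝ :=
  (1 / 2) * ∑ p, (g x)⁻¹ l p *
    (pderiv (fun y => g y j p) i x + pderiv (fun y => g y i p) j x - pderiv (fun y => g y i j) p x)

/-- The component `dx_l (R(∂_i, ∂_j) ∂_k)` of the Riemann curvature tensor. -/
noncomputable def riemannTensor {d : ℕ} (g : (Fin d → ℝ) → Matrix (Fin d) (Fin d) ℝ)
    (l k i j : Fin d) (x : Fin d → ℝ) : ℝ :=
  pderiv (christoffel g l j k) i x - pderiv (christoffel g l i k) j x
    + ∑ p, (christoffel g l i p x * christoffel g p j k x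
        - christoffel g l j p x * christoffel g p i k x)

/-- The metric `g` is flat on `W`: its Riemann curvature tensor vanishes. -/
def IsFlatMetricOn {d : ℕ} (g : (Fin d → ℝ) → Matrix (Fin d) (Fin d) ℝ)
    (W : Set (Fin d → ℝ)) : Prop :=
  ∀ x ∈ W, ∀ l k i j, riemannTensor g l k i j x = 0

/-! ### Flat Lagrangian immersions into `ℂP^{n-1}` -/

/-- The Fubini-Study Hermitian form at `[z]`, evaluated on the images under the differential of
`ℂⁿ ∖ {0} → ℂP^{n-1}` at `z` of the vectors `u, v`.  Its real part is the Fubini-Study metric (for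
which the Hopf fibration is a Riemannian submersion), its imaginary part the Kähler form. -/
noncomputable def fubiniStudy {n : ℕ} (z u v : EuclideanSpace ℂ (Fin n)) : ℂ :=
  inner ℂ u v / (‖z‖ : ℂ) ^ 2 - inner ℂ u z * inner ℂ z v / (‖z‖ : ℂ) ^ 4

/-- The metric induced by the Fubini-Study metric through the map `v ↦ [Z v]`. -/
noncomputable def inducedFS {n d : ℕ} (Z : (Fin d → ℝ) → EuclideanSpace ℂ (Fin n))
    (v : Fin d → ℝ) : Matrix (Fin d) (Fin d) ℝ :=
  Matrix.of fun a b => (fubiniStudy (Z v) (pderiv Z a v) (pderiv Z b v)).re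

/-- `Y : V → ℂP^{n-1}` is a smooth flat Lagrangian immersion of the open set `V ⊆ ℝ^{n-1}`.
Everything is expressed through smooth local lifts `Z` of `Y` to `ℂⁿ ∖ {0}` (none of the conditions
depends on the lift): the differential of `Y` is injective (the kernel of the differential of
`ℂⁿ ∖ {0} → ℂP^{n-1}` at `z` is the line `ℂ z`), the pull-back of the Kähler form vanishes
(`V` has half the real dimension of `ℂP^{n-1}`), and the induced metric is flat. -/
def IsFlatLagrangianImmersion {n : ℕ} (Y : (Fin (n - 1) → ℝ) → CProj n)
    (V : Set (Fin (n - 1) → ℝ)) : Prop :=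
  ∀ v ∈ V, ∃ W : Set (Fin (n - 1) → ℝ), IsOpen W ∧ v ∈ W ∧ W ⊆ V ∧
    ∃ Z : (Fin (n - 1) → ℝ) → EuclideanSpace ℂ (Fin n),
      ContDiffOn ℝ ∞ Z W ∧
      (∀ u ∈ W, ∃ h : Z u ≠ 0, Y u = Projectivization.mk ℂ (Z u) h) ∧
      (∀ u ∈ W, ∀ w : Fin (n - 1) → ℝ, w ≠ 0 → ∀ c : ℂ, fderiv ℝ Z u w ≠ c • Z u) ∧
      (∀ u ∈ W, ∀ a b, (fubiniStudy (Z u) (pderiv Z a u) (pderiv Z b u)).im = 0) ∧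
      IsFlatMetricOn (inducedFS Z) W

/-- `f : W → ℂP^{n-1}` is a smooth submersion `q` of `W` onto an open set `V ⊆ ℝ^{n-1}` followed by
a flat Lagrangian immersion `Y` of `V`.  In particular `f(W) = Y(V)` is an (immersed) flat
Lagrangian submanifold of `ℂP^{n-1}`. -/
def ImageIsFlatLagrangian {n : ℕ} (f : (Fin n → ℝ) → CProj n) (W : Set (Fin n → ℝ)) : Prop :=
  ∃ (V : Set (Fin (n - 1) → ℝ)) (q : (Fin n → ℝ) → (Fin (n - 1) → ℝ))
    (Y : (Fin (n - 1) → ℝ) → CProj n),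
    IsOpen V ∧ ContDiffOn ℝ ∞ q W ∧ (∀ x ∈ W, Function.Surjective (fderiv ℝ q x)) ∧
    q '' W = V ∧ IsFlatLagrangianImmersion Y V ∧ ∀ x ∈ W, f x = Y (q x)

/-- `O` is a union of full lines in the direction `(1, …, 1)`. -/
def IsDiagonallySaturated {n : ℕ} (O : Set (Fin n → ℝ)) : Prop :=
  ∀ x ∈ O, ∀ t : ℝ, (x + fun _ => t) ∈ O

/-!
Write `a_{lj}` for the entries of `A` and `N_k` for the columns of `U A`, a unitary frame. The two
frame equations say

* `∂_k X = i a_{mk} N_k` and `X = ∑_j a_{mj} N_j` (`IsUnitaryFrame.pderiv_columnMap`,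
  `columnMap_eq_sum_frameVector`);
* `∂_k a_{lj} = a_{lk} f_{kj}` for `k ≠ j`, and `∑_k ∂_k a_{lj} = 0`
  (`IsOrthogonalFrame.pderiv_entry`, `IsOrthogonalFrame.sum_pderiv_entry`).

Hence `A` is constant along the diagonal direction `𝟏`, whereas `∑_k ∂_k X = i X`, so the diagonal
flow acts on `X` by `e^{it}` (`IsUnitaryFrame.columnMap_add_diagonal`). This gives the saturation
statements, and shows that `π ∘ X` factors through the quotient of `ℝⁿ` by `ℝ𝟏`. The quotient is
`x ↦ (x_j - x_0)_{j ≥ 1}`, with section `v ↦ (0, v) + c𝟏`, and `X` restricted to the image of the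
section is a lift of the induced map into projective space.

In the frame `N` the pulled-back Fubini–Study form is `a_{mi}² δ_{ij} - a_{mi}² a_{mj}²`
(`fubiniStudy_frameVector`). It is real, which is the Lagrangian condition. Orthogonality of the
columns of `A` writes it as `∑_{l ≠ m} θ^l ⊗ θ^l` with `θ^l = ∑_b a_{mb} a_{lb} dx_b`. These forms
are closed because `F` is symmetric (`pderiv_sliceCoframe_comm`) and independent because no
`a_{mj}` vanishes (`sliceCoframe_det_ne_zero`), and a metric with a closed orthonormal coframe is
flat (`isFlatMetricOn_of_closed_coframe`).
-/

/-! ### Calculus with partial derivatives -/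

section PartialDerivatives

variable {k : ℕ} {G : Type*} [NormedAddCommGroup G] [NormedSpace ℝ G]

theorem fderiv_apply_eq_sum_pderiv (f : (Fin k → ℝ) → G) (x w : Fin k → ℝ) :
    fderiv ℝ f x w = ∑ j, w j • pderiv f j x := by
  conv_lhs => rw [pi_eq_sum_univ' w]
  simp [pderiv, map_sum]

theorem pderiv_congr_of_eqOn {f g : (Fin k → ℝ) → G} {W : Set (Fin k → ℝ)} (hW : IsOpen W)
    (h : Set.EqOn f g W) {x : Fin k → ℝ} (hx : x ∈ W) (j : Fin k) :
    pderiv f j x = pderiv g j x := by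
  unfold pderiv
  rw [(h.eventuallyEq_of_mem (hW.mem_nhds hx)).fderiv_eq]

theorem pderiv_mul {f g : (Fin k → ℝ) → ℝ} {x : Fin k → ℝ} (hf : DifferentiableAt ℝ f x)
    (hg : DifferentiableAt ℝ g x) (j : Fin k) :
    pderiv (fun y => f y * g y) j x = pderiv f j x * g x + f x * pderiv g j x := by
  unfold pderiv
  rw [fderiv_fun_mul hf hg]
  simp
  ring

theorem pderiv_sum {ι : Type*} (s : Finset ι) {f : ι → (Fin k → ℝ) → G} {x : Fin k → ℝ}
    (hf : ∀ i ∈ s, DifferentiableAt ℝ (f i) x) (j : Fin k) :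
    pderiv (fun y => ∑ i ∈ s, f i y) j x = ∑ i ∈ s, pderiv (f i) j x := by
  unfold pderiv
  rw [fderiv_fun_sum hf]
  simp

theorem contDiffAt_pderiv {f : (Fin k → ℝ) → G} {x : Fin k → ℝ} (hf : ContDiffAt ℝ ∞ f x)
    (j : Fin k) : ContDiffAt ℝ ∞ (pderiv f j) x := by
  unfold pderiv
  exact (hf.fderiv_right (m := ∞) (by simp)).clm_apply contDiffAt_const

theorem pderiv_comm {f : (Fin k → ℝ) → G} {x : Fin k → ℝ} (hf : ContDiffAt ℝ ∞ f x)
    (i j : Fin k) : pderiv (pderiv f j) i x = pderiv (pderiv f i) j x := by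
  have h1 : DifferentiableAt ℝ (fderiv ℝ f) x :=
    (hf.fderiv_right (m := ∞) (by simp)).differentiableAt (by simp)
  have key : ∀ a b : Fin k, pderiv (pderiv f b) a x
      = fderiv ℝ (fderiv ℝ f) x (Pi.single a 1) (Pi.single b 1) := by
    intro a b
    change fderiv ℝ (fun y => fderiv ℝ f y (Pi.single b 1)) x (Pi.single a 1) = _
    rw [fderiv_clm_apply h1 (differentiableAt_const _)]
    simp
  rw [key, key]
  exact (hf.isSymmSndFDerivAt (by simpa using WithTop.coe_le_coe.2 (le_top (a := (2 : ℕ∞))))) _ _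

end PartialDerivatives

/-! ### Closed coframes and flat metrics -/

theorem contDiffAt_matrix_det {E : Type*} [NormedAddCommGroup E] [NormedSpace ℝ E] {d : ℕ}
    {B : E → Matrix (Fin d) (Fin d) ℝ} {x : E}
    (hB : ∀ i j, ContDiffAt ℝ ∞ (fun y => B y i j) x) :
    ContDiffAt ℝ ∞ (fun y => (B y).det) x := by
  simp only [Matrix.det_apply]
  exact ContDiffAt.sum fun σ _ => (contDiffAt_prod fun i _ => hB _ _).const_smul _

theorem contDiffAt_matrix_inv {E : Type*} [NormedAddCommGroup E] [NormedSpace ℝ E] {d : ℕ}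
    {B : E → Matrix (Fin d) (Fin d) ℝ} {x : E}
    (hB : ∀ i j, ContDiffAt ℝ ∞ (fun y => B y i j) x) (hx : (B x).det ≠ 0) (i j : Fin d) :
    ContDiffAt ℝ ∞ (fun y => (B y)⁻¹ i j) x := by
  simp only [Matrix.inv_def, Matrix.smul_apply, Matrix.adjugate_apply, Ring.inverse_eq_inv',
    smul_eq_mul]
  refine ((contDiffAt_matrix_det hB).inv hx).mul (contDiffAt_matrix_det fun a b => ?_)
  by_cases h : a = j
  · subst h
    simpa using contDiffAt_const
  · simpa [Matrix.updateRow_ne h] using hB a b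

section Coframe

variable {d : ℕ} {J g : (Fin d → ℝ) → Matrix (Fin d) (Fin d) ℝ} {W : Set (Fin d → ℝ)}

/-- For a metric `g = Jᵀ J` with closed coframe `J`, the connection matrices are
`Γ_i = J⁻¹ ∂_i J`. -/
theorem christoffel_eq_of_closed_coframe (hW : IsOpen W) (hJ : MatSmoothOn J W)
    (hdet : ∀ v ∈ W, (J v).det ≠ 0)
    (hclosed : ∀ v ∈ W, ∀ l i j, pderiv (fun y => J y l j) i v = pderiv (fun y => J y l i) j v)
    (hg : ∀ v ∈ W, g v = (J v)ᵀ * J v) {v : Fin d → ℝ} (hv : v ∈ W) (l i j : Fin d) :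
    christoffel g l i j v = ∑ p, (J v)⁻¹ l p * pderiv (fun y => J y p j) i v := by
  have hd : ∀ a b, DifferentiableAt ℝ (fun y => J y a b) v := fun a b =>
    ((hJ a b).contDiffAt (hW.mem_nhds hv)).differentiableAt (by simp)
  have hdg : ∀ a b c, pderiv (fun y => g y a b) c v
      = ∑ r, (pderiv (fun y => J y r a) c v * J v r b
          + J v r a * pderiv (fun y => J y r b) c v) := by
    intro a b c
    rw [pderiv_congr_of_eqOn (g := fun y => ∑ r, J y r a * J y r b) hW
      (fun y hy => by simp [hg y hy, Matrix.mul_apply]) hv,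
      pderiv_sum (f := fun r y => J y r a * J y r b) _ fun r _ => (hd r a).fun_mul (hd r b)]
    exact Finset.sum_congr rfl fun r _ => pderiv_mul (hd r a) (hd r b) c
  have hfirst : ∀ p, pderiv (fun y => g y j p) i v + pderiv (fun y => g y i p) j v
      - pderiv (fun y => g y i j) p v
      = 2 * ((J v)ᵀ * Matrix.of fun r b => pderiv (fun y => J y r b) i v) p j := by
    intro p
    rw [hdg, hdg, hdg, ← Finset.sum_add_distrib, ← Finset.sum_sub_distrib, Matrix.mul_apply,
      Finset.mul_sum]
    refine Finset.sum_congr rfl fun r _ => ?_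
    simp only [Matrix.transpose_apply, Matrix.of_apply]
    rw [hclosed v hv r j i, hclosed v hv r i p, hclosed v hv r j p]
    ring
  have hu : IsUnit (J v).det := (hdet v hv).isUnit
  have hinv : (g v)⁻¹ * (J v)ᵀ = (J v)⁻¹ := by
    rw [hg v hv, Matrix.mul_inv_rev, Matrix.mul_assoc, Matrix.nonsing_inv_mul, Matrix.mul_one]
    rwa [Matrix.det_transpose]
  unfold christoffel
  simp only [hfirst]
  have : ∑ p, (J v)⁻¹ l p * pderiv (fun y => J y p j) i v
      = ((g v)⁻¹ * ((J v)ᵀ * Matrix.of fun r b => pderiv (fun y => J y r b) i v)) l j := by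
    rw [← Matrix.mul_assoc, hinv, Matrix.mul_apply]
    simp
  rw [this, Matrix.mul_apply, Finset.mul_sum]
  exact Finset.sum_congr rfl fun p _ => by ring

/-- A metric `g = Jᵀ J` with a closed invertible coframe `J` is flat: the rows of `J` are locally
differentials of Euclidean coordinates. The computation differentiates `J Γ_j = ∂_j J` and uses
the symmetry of second derivatives. -/
theorem isFlatMetricOn_of_closed_coframe (hW : IsOpen W) (hJ : MatSmoothOn J W)
    (hdet : ∀ v ∈ W, (J v).det ≠ 0)
    (hclosed : ∀ v ∈ W, ∀ l i j, pderiv (fun y => J y l j) i v = pderiv (fun y => J y l i) j v)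
    (hg : ∀ v ∈ W, g v = (J v)ᵀ * J v) : IsFlatMetricOn g W := by
  intro v hv l k i j
  have hs : ∀ a b, ContDiffAt ℝ ∞ (fun y => J y a b) v := fun a b =>
    (hJ a b).contDiffAt (hW.mem_nhds hv)
  have hΓs : ∀ a b c, DifferentiableAt ℝ (christoffel g a b c) v := by
    intro a b c
    have h : ContDiffAt ℝ ∞ (fun y => ∑ p, (J y)⁻¹ a p * pderiv (fun z => J z p c) b y) v :=
      ContDiffAt.sum fun p _ =>
        (contDiffAt_matrix_inv hs (hdet v hv) a p).mul (contDiffAt_pderiv (hs p c) b)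
    refine (h.differentiableAt (by simp)).congr_of_eventuallyEq ?_
    filter_upwards [hW.mem_nhds hv] with y hy
    exact christoffel_eq_of_closed_coframe hW hJ hdet hclosed hg hy a b c
  have hJΓ : ∀ y ∈ W, ∀ r b c,
      ∑ a, J y r a * christoffel g a b c y = pderiv (fun z => J z r c) b y := by
    intro y hy r b c
    have : ∀ a, christoffel g a b c y
        = ((J y)⁻¹ * Matrix.of fun p q => pderiv (fun z => J z p q) b y) a c := fun a => by
      rw [christoffel_eq_of_closed_coframe hW hJ hdet hclosed hg hy a b c, Matrix.mul_apply]
      rfl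
    simp only [this]
    rw [← Matrix.mul_apply, ← Matrix.mul_assoc, Matrix.mul_nonsing_inv _ (hdet y hy).isUnit,
      Matrix.one_mul]
    rfl
  have hdJΓ : ∀ r b c, ∑ a, (pderiv (fun z => J z r a) b v * christoffel g a c k v
      + J v r a * pderiv (christoffel g a c k) b v)
      = pderiv (pderiv (fun z => J z r k) c) b v := by
    intro r b c
    rw [← pderiv_congr_of_eqOn hW (fun y hy => hJΓ y hy r c k) hv,
      pderiv_sum (f := fun a y => J y r a * christoffel g a c k y) _ fun a _ =>
        ((hs r a).differentiableAt (by simp)).fun_mul (hΓs a c k)]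
    exact Finset.sum_congr rfl fun a _ =>
      (pderiv_mul ((hs r a).differentiableAt (by simp)) (hΓs a c k) b).symm
  have hJR : J v *ᵥ (fun a => riemannTensor g a k i j v) = 0 := by
    ext r
    have hquad : ∀ b c, ∑ a, J v r a * ∑ p, christoffel g a b p v * christoffel g p c k v
        = ∑ p, pderiv (fun z => J z r p) b v * christoffel g p c k v := by
      intro b c
      simp only [Finset.mul_sum, ← hJΓ v hv, Finset.sum_mul]
      rw [Finset.sum_comm]
      simp only [mul_assoc]
    have h1 := hdJΓ r i j
    have h2 := hdJΓ r j i
    rw [pderiv_comm (hs r k) i j, ← h2] at h1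
    simp only [Finset.sum_add_distrib] at h1
    simp only [Matrix.mulVec, dotProduct, riemannTensor, Finset.sum_sub_distrib, mul_add, mul_sub,
      Finset.sum_add_distrib, hquad, Pi.zero_apply]
    linarith
  exact congrFun (Matrix.eq_zero_of_mulVec_eq_zero (hdet v hv) hJR) l

end Coframe

/-! ### Structure equations of the frames -/

section Frames

variable {n : ℕ} {Ω : Set (Fin n → ℝ)} {F : (Fin n → ℝ) → Matrix (Fin n) (Fin n) ℝ}
  {A : (Fin n → ℝ) → Matrix.orthogonalGroup (Fin n) ℝ}
  {U : (Fin n → ℝ) → Matrix.unitaryGroup (Fin n) ℂ}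

theorem IsOrthogonalFrame.pderiv_entry (hA : IsOrthogonalFrame F A Ω) {x : Fin n → ℝ}
    (hx : x ∈ Ω) (l j k : Fin n) :
    pderiv (fun y => (A y : Matrix (Fin n) (Fin n) ℝ) l j) k x
      = (A x : Matrix (Fin n) (Fin n) ℝ) l k * F x k j
        - if k = j then ∑ p, (A x : Matrix (Fin n) (Fin n) ℝ) l p * F x p k else 0 := by
  have hmul : (A x : Matrix (Fin n) (Fin n) ℝ)
      * (((A x)⁻¹ : Matrix.orthogonalGroup (Fin n) ℝ) : Matrix (Fin n) (Fin n) ℝ) = 1 :=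
    congrArg Subtype.val (mul_inv_cancel (A x))
  have h := congrArg ((A x : Matrix (Fin n) (Fin n) ℝ) * ·) (hA.2 x hx k)
  simp only [← Matrix.mul_assoc, hmul, Matrix.one_mul, Matrix.mul_sub, deltaForm] at h
  have h' := congrFun (congrFun h l) j
  simp only [matPderiv, Matrix.of_apply] at h'
  rw [h', Matrix.sub_apply]
  congr 1
  · simp [Matrix.mul_apply, Matrix.single_apply, Finset.sum_ite_eq, ite_and]
  · rw [Matrix.mul_apply]
    simp [Matrix.mul_apply, Matrix.single_apply, ite_and]

theorem IsOrthogonalFrame.pderiv_entry_of_ne (hA : IsOrthogonalFrame F A Ω) {x : Fin n → ℝ}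
    (hx : x ∈ Ω) (l : Fin n) {j k : Fin n} (h : k ≠ j) :
    pderiv (fun y => (A y : Matrix (Fin n) (Fin n) ℝ) l j) k x
      = (A x : Matrix (Fin n) (Fin n) ℝ) l k * F x k j := by
  rw [hA.pderiv_entry hx, if_neg h, sub_zero]

theorem IsOrthogonalFrame.sum_pderiv_entry (hA : IsOrthogonalFrame F A Ω) {x : Fin n → ℝ}
    (hx : x ∈ Ω) (l j : Fin n) :
    ∑ k, pderiv (fun y => (A y : Matrix (Fin n) (Fin n) ℝ) l j) k x = 0 := by
  simp [hA.pderiv_entry hx, Finset.sum_sub_distrib]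

theorem orthogonalGroup_sum_mul_row (A : Matrix.orthogonalGroup (Fin n) ℝ) (i j : Fin n) :
    ∑ k, (A : Matrix (Fin n) (Fin n) ℝ) i k * (A : Matrix (Fin n) (Fin n) ℝ) j k
      = if i = j then 1 else 0 := by
  have h := congrFun (congrFun ((Matrix.mem_orthogonalGroup_iff _ _).1 A.2) i) j
  simpa [Matrix.mul_apply, Matrix.one_apply] using h

theorem orthogonalGroup_sum_mul_column (A : Matrix.orthogonalGroup (Fin n) ℝ) (i j : Fin n) :
    ∑ k, (A : Matrix (Fin n) (Fin n) ℝ) k i * (A : Matrix (Fin n) (Fin n) ℝ) k j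
      = if i = j then 1 else 0 := by
  have h := congrFun (congrFun ((Matrix.mem_orthogonalGroup_iff' _ _).1 A.2) i) j
  simpa [Matrix.mul_apply, Matrix.one_apply] using h

/-- The `k`-th column of `U A`. These vectors form a unitary frame in which `∂X/∂x_k` is a
multiple of the `k`-th vector. -/
noncomputable def frameVector (A : (Fin n → ℝ) → Matrix.orthogonalGroup (Fin n) ℝ)
    (U : (Fin n → ℝ) → Matrix.unitaryGroup (Fin n) ℂ) (k : Fin n) (x : Fin n → ℝ) :
    EuclideanSpace ℂ (Fin n) :=
  WithLp.toLp 2 fun i => ∑ p, (U x : Matrix (Fin n) (Fin n) ℂ) i p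
    * ((A x : Matrix (Fin n) (Fin n) ℝ) p k : ℂ)

theorem inner_frameVector (A : (Fin n → ℝ) → Matrix.orthogonalGroup (Fin n) ℝ)
    (U : (Fin n → ℝ) → Matrix.unitaryGroup (Fin n) ℂ) (x : Fin n → ℝ) (j k : Fin n) :
    inner ℂ (frameVector A U j x) (frameVector A U k x) = if j = k then 1 else 0 := by
  set B : Matrix (Fin n) (Fin n) ℂ := (A x : Matrix (Fin n) (Fin n) ℝ).map Complex.ofReal with hB
  have hU : star (U x : Matrix (Fin n) (Fin n) ℂ) * (U x : Matrix (Fin n) (Fin n) ℂ) = 1 :=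
    Matrix.UnitaryGroup.star_mul_self (U x)
  have hBB : star B * B = 1 := by
    ext a b
    have := congrArg Complex.ofReal (orthogonalGroup_sum_mul_column (A x) a b)
    simp only [Matrix.mul_apply, Matrix.star_apply, hB, Matrix.map_apply, Matrix.one_apply]
    simpa [apply_ite Complex.ofReal] using this
  have h : star ((U x : Matrix (Fin n) (Fin n) ℂ) * B) * ((U x : Matrix (Fin n) (Fin n) ℂ) * B)
      = 1 := by
    rw [star_mul, Matrix.mul_assoc, ← Matrix.mul_assoc (star (U x : Matrix (Fin n) (Fin n) ℂ)),
      hU, Matrix.one_mul, hBB]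
  rw [← Matrix.one_apply, ← h, Matrix.mul_apply, PiLp.inner_apply]
  refine Finset.sum_congr rfl fun i _ => ?_
  rw [RCLike.inner_apply, mul_comm]
  rfl

theorem columnMap_eq_sum_frameVector (A : (Fin n → ℝ) → Matrix.orthogonalGroup (Fin n) ℝ)
    (U : (Fin n → ℝ) → Matrix.unitaryGroup (Fin n) ℂ) (m : Fin n) (x : Fin n → ℝ) :
    (columnMap U m x : EuclideanSpace ℂ (Fin n))
      = ∑ j, ((A x : Matrix (Fin n) (Fin n) ℝ) m j : ℂ) • frameVector A U j x := by
  ext i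
  have h : ∀ p, ∑ j, ((A x : Matrix (Fin n) (Fin n) ℝ) m j : ℂ)
      * ((A x : Matrix (Fin n) (Fin n) ℝ) p j : ℂ) = if m = p then 1 else 0 := fun p => by
    simpa [apply_ite Complex.ofReal] using
      congrArg Complex.ofReal (orthogonalGroup_sum_mul_row (A x) m p)
  simp only [columnMap, frameVector, WithLp.ofLp_sum, Finset.sum_apply, WithLp.ofLp_smul,
    Pi.smul_apply, smul_eq_mul, Finset.mul_sum]
  rw [Finset.sum_comm]
  have h' : ∀ p, ∑ j, ((A x : Matrix (Fin n) (Fin n) ℝ) m j : ℂ)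
      * ((U x : Matrix (Fin n) (Fin n) ℂ) i p * ((A x : Matrix (Fin n) (Fin n) ℝ) p j : ℂ))
      = (U x : Matrix (Fin n) (Fin n) ℂ) i p * if m = p then 1 else 0 := fun p => by
    rw [← h p, Finset.mul_sum]
    exact Finset.sum_congr rfl fun j _ => mul_left_comm _ _ _
  rw [Finset.sum_congr rfl fun p _ => h' p]
  simp

theorem IsUnitaryFrame.contDiffOn_columnMap (hU : IsUnitaryFrame A U Ω) (m : Fin n) :
    ContDiffOn ℝ ∞ (fun x => (columnMap U m x : EuclideanSpace ℂ (Fin n))) Ω :=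
  contDiffOn_piLp _ |>.2 fun i => hU.1 i m

theorem IsUnitaryFrame.differentiableAt_columnMap (hΩ : IsOpen Ω) (hU : IsUnitaryFrame A U Ω)
    (m : Fin n) {x : Fin n → ℝ} (hx : x ∈ Ω) :
    DifferentiableAt ℝ (fun x => (columnMap U m x : EuclideanSpace ℂ (Fin n))) x :=
  ((hU.contDiffOn_columnMap m).contDiffAt (hΩ.mem_nhds hx)).differentiableAt (by simp)

theorem IsUnitaryFrame.pderiv_columnMap (hΩ : IsOpen Ω) (hU : IsUnitaryFrame A U Ω)
    (m : Fin n) {x : Fin n → ℝ} (hx : x ∈ Ω) (k : Fin n) :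
    pderiv (fun y => (columnMap U m y : EuclideanSpace ℂ (Fin n))) k x
      = (Complex.I * ((A x : Matrix (Fin n) (Fin n) ℝ) m k : ℂ)) • frameVector A U k x := by
  have hmul : (U x : Matrix (Fin n) (Fin n) ℂ)
      * (((U x)⁻¹ : Matrix.unitaryGroup (Fin n) ℂ) : Matrix (Fin n) (Fin n) ℂ) = 1 :=
    congrArg Subtype.val (mul_inv_cancel (U x))
  have h := congrArg ((U x : Matrix (Fin n) (Fin n) ℂ) * ·) (hU.2 x hx k)
  simp only [← Matrix.mul_assoc, hmul, Matrix.one_mul, deltaForm] at h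
  ext i
  have h' := congrFun (congrFun h i) m
  simp only [matPderiv, Matrix.of_apply] at h'
  have hproj : pderiv (fun y => (columnMap U m y : EuclideanSpace ℂ (Fin n))) k x i
      = pderiv (fun y => (U y : Matrix (Fin n) (Fin n) ℂ) i m) k x := by
    have := ((EuclideanSpace.proj (𝕜 := ℂ) i : EuclideanSpace ℂ (Fin n) →L[ℂ] ℂ).restrictScalars ℝ
      |>.hasFDerivAt.comp x (hU.differentiableAt_columnMap hΩ m hx).hasFDerivAt).fderiv
    exact (congrArg (fun L => L (Pi.single k 1)) this).symm
  rw [hproj, h', Matrix.mul_apply]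
  simp [frameVector, Matrix.mul_apply, Matrix.single_apply, ite_and, Finset.mul_sum, mul_comm]
  exact Finset.sum_congr rfl fun p _ => by ring

end Frames

/-! ### The diagonal flow -/

theorem hasDerivAt_along_diagonal {n : ℕ} {E : Type*} [NormedAddCommGroup E] [NormedSpace ℝ E]
    {f : (Fin n → ℝ) → E} {x : Fin n → ℝ} {s : ℝ}
    (hf : DifferentiableAt ℝ f (x + fun _ => s)) :
    HasDerivAt (fun t : ℝ => f (x + fun _ => t)) (∑ k, pderiv f k (x + fun _ => s)) s := by
  have h1 : HasDerivAt (fun t : ℝ => x + fun _ : Fin n => t) (fun _ => (1 : ℝ)) s :=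
    (hasDerivAt_pi.2 fun _ => hasDerivAt_id s).const_add x
  have h2 := hf.hasFDerivAt.comp_hasDerivAt s h1
  rw [fderiv_apply_eq_sum_pderiv] at h2
  simpa [Function.comp_def] using h2

theorem eq_of_hasDerivAt_zero_on_uIcc {E : Type*} [NormedAddCommGroup E] [NormedSpace ℝ E]
    {g : ℝ → E} {a b : ℝ} (hg : ∀ s ∈ Set.uIcc a b, HasDerivAt g 0 s) : g b = g a := by
  have h := (convex_uIcc a b).norm_image_sub_le_of_norm_hasDerivWithin_le (C := 0) (f := g)
    (f' := fun _ => 0) (fun s hs => (hg s hs).hasDerivWithinAt) (by simp)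
    Set.left_mem_uIcc Set.right_mem_uIcc
  simpa [sub_eq_zero] using h

section DiagonalFlow

variable {n : ℕ} {Ω : Set (Fin n → ℝ)} {F : (Fin n → ℝ) → Matrix (Fin n) (Fin n) ℝ}
  {A : (Fin n → ℝ) → Matrix.orthogonalGroup (Fin n) ℝ}
  {U : (Fin n → ℝ) → Matrix.unitaryGroup (Fin n) ℂ}

theorem IsOrthogonalFrame.entry_add_diagonal (hΩ : IsOpen Ω) (hA : IsOrthogonalFrame F A Ω)
    {x : Fin n → ℝ} {t : ℝ} (hx : ∀ s ∈ Set.uIcc 0 t, (x + fun _ => s) ∈ Ω) (l j : Fin n) :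
    (A (x + fun _ => t) : Matrix (Fin n) (Fin n) ℝ) l j
      = (A x : Matrix (Fin n) (Fin n) ℝ) l j := by
  have h := eq_of_hasDerivAt_zero_on_uIcc (a := 0) (b := t)
    (g := fun s => (A (x + fun _ => s) : Matrix (Fin n) (Fin n) ℝ) l j) fun s hs => by
      rw [← hA.sum_pderiv_entry (hx s hs) l j]
      exact hasDerivAt_along_diagonal
        (f := fun y => (A y : Matrix (Fin n) (Fin n) ℝ) l j)
        (((hA.1 l j).contDiffAt (hΩ.mem_nhds (hx s hs))).differentiableAt (by simp))
  have h0 : (x + fun _ => (0 : ℝ)) = x := by ext; simp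
  rw [h0] at h
  exact h

theorem IsUnitaryFrame.sum_pderiv_columnMap (hΩ : IsOpen Ω) (hU : IsUnitaryFrame A U Ω)
    (m : Fin n) {x : Fin n → ℝ} (hx : x ∈ Ω) :
    ∑ k, pderiv (fun y => (columnMap U m y : EuclideanSpace ℂ (Fin n))) k x
      = Complex.I • (columnMap U m x : EuclideanSpace ℂ (Fin n)) := by
  rw [columnMap_eq_sum_frameVector A U m x, Finset.smul_sum]
  exact Finset.sum_congr rfl fun k _ => by rw [hU.pderiv_columnMap hΩ m hx, mul_smul]

/-- `∑_k ∂X/∂x_k = i X`, so `e^{-it} X(x + t𝟏)` is constant in `t`. -/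
theorem IsUnitaryFrame.columnMap_add_diagonal (hΩ : IsOpen Ω) (hU : IsUnitaryFrame A U Ω)
    (m : Fin n) {x : Fin n → ℝ} {t : ℝ} (hx : ∀ s ∈ Set.uIcc 0 t, (x + fun _ => s) ∈ Ω) :
    (columnMap U m (x + fun _ => t) : EuclideanSpace ℂ (Fin n))
      = Complex.exp (t * Complex.I) • (columnMap U m x : EuclideanSpace ℂ (Fin n)) := by
  have h := eq_of_hasDerivAt_zero_on_uIcc (a := 0) (b := t)
    (g := fun s => Complex.exp (-(s * Complex.I))
      • (columnMap U m (x + fun _ => s) : EuclideanSpace ℂ (Fin n))) fun s hs => by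
      have h1 := hasDerivAt_along_diagonal
        (f := fun y => (columnMap U m y : EuclideanSpace ℂ (Fin n)))
        (hU.differentiableAt_columnMap hΩ m (hx s hs))
      rw [hU.sum_pderiv_columnMap hΩ m (hx s hs)] at h1
      have h2 : HasDerivAt (fun r : ℝ => Complex.exp (-(r * Complex.I)))
          (Complex.exp (-(s * Complex.I)) * -(1 * Complex.I)) s :=
        (((hasDerivAt_id s).ofReal_comp.mul_const Complex.I).neg).cexp
      convert h2.fun_smul h1 using 1
      rw [smul_smul, ← add_smul]
      simp
  have h0 : (x + fun _ => (0 : ℝ)) = x := by ext; simp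
  simp only [h0, Complex.ofReal_zero, zero_mul, neg_zero, Complex.exp_zero, one_smul] at h
  rw [← h, smul_smul, ← Complex.exp_add]
  simp

theorem IsUnitaryFrame.hopf_columnMap_add_diagonal (hΩ : IsOpen Ω) (hU : IsUnitaryFrame A U Ω)
    (m : Fin n) {x : Fin n → ℝ} {t : ℝ} (hx : ∀ s ∈ Set.uIcc 0 t, (x + fun _ => s) ∈ Ω) :
    hopf (columnMap U m (x + fun _ => t)) = hopf (columnMap U m x) :=
  (Projectivization.mk_eq_mk_iff' _ _ _ _ _).2 ⟨_, (hU.columnMap_add_diagonal hΩ m hx).symm⟩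

/-- Two points of a Hopf fibre differ by a phase `e^{it}`, and the diagonal flow realises every
phase on a saturated set. -/
theorem IsUnitaryFrame.image_eq_hopf_preimage (hΩ : IsOpen Ω) (hU : IsUnitaryFrame A U Ω)
    (m : Fin n) (hsat : IsDiagonallySaturated Ω) :
    columnMap U m '' Ω = hopf ⁻¹' (hopf '' (columnMap U m '' Ω)) := by
  refine (Set.subset_preimage_image _ _).antisymm ?_
  rintro z ⟨_, ⟨x, hx, rfl⟩, hz⟩
  obtain ⟨a, ha⟩ := (Projectivization.mk_eq_mk_iff' _ _ _ _ _).1 hz.symm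
  have hnorm : ‖a‖ = 1 := by
    have := congrArg norm ha
    simpa [norm_smul] using this
  refine ⟨x + fun _ => a.arg, hsat x hx _, Subtype.ext ?_⟩
  rw [hU.columnMap_add_diagonal hΩ m fun s _ => hsat x hx s, ← ha]
  congr 1
  simpa [hnorm] using Complex.norm_mul_exp_arg_mul_I a

end DiagonalFlow

/-! ### The induced Fubini–Study form -/

section FubiniStudy

variable {n : ℕ} (A : (Fin n → ℝ) → Matrix.orthogonalGroup (Fin n) ℝ)
  (U : (Fin n → ℝ) → Matrix.unitaryGroup (Fin n) ℂ) (m : Fin n) (x : Fin n → ℝ)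

theorem inner_frameVector_columnMap (j : Fin n) :
    inner ℂ (frameVector A U j x) (columnMap U m x : EuclideanSpace ℂ (Fin n))
      = ((A x : Matrix (Fin n) (Fin n) ℝ) m j : ℂ) := by
  rw [columnMap_eq_sum_frameVector A U m x, inner_sum]
  simp_rw [inner_smul_right, inner_frameVector]
  simp

theorem inner_columnMap_frameVector (j : Fin n) :
    inner ℂ (columnMap U m x : EuclideanSpace ℂ (Fin n)) (frameVector A U j x)
      = ((A x : Matrix (Fin n) (Fin n) ℝ) m j : ℂ) := by
  rw [← inner_conj_symm, inner_frameVector_columnMap, Complex.conj_ofReal]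

theorem fubiniStudy_frameVector (j k : Fin n) :
    fubiniStudy (columnMap U m x : EuclideanSpace ℂ (Fin n))
        ((Complex.I * ((A x : Matrix (Fin n) (Fin n) ℝ) m j : ℂ)) • frameVector A U j x)
        ((Complex.I * ((A x : Matrix (Fin n) (Fin n) ℝ) m k : ℂ)) • frameVector A U k x)
      = (((if j = k then (A x : Matrix (Fin n) (Fin n) ℝ) m j ^ 2 else 0)
          - (A x : Matrix (Fin n) (Fin n) ℝ) m j ^ 2
            * (A x : Matrix (Fin n) (Fin n) ℝ) m k ^ 2 : ℝ) : ℂ) := by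
  have hnorm : ‖(columnMap U m x : EuclideanSpace ℂ (Fin n))‖ = 1 := by simp
  simp only [fubiniStudy, hnorm, inner_smul_left, inner_smul_right, inner_frameVector,
    inner_frameVector_columnMap, inner_columnMap_frameVector, map_mul, Complex.conj_I,
    Complex.conj_ofReal, Complex.ofReal_one, one_pow, div_one]
  have hI : Complex.I * Complex.I = -1 := Complex.I_mul_I
  split_ifs with h
  · subst h
    push_cast
    linear_combination (((A x : Matrix (Fin n) (Fin n) ℝ) m j : ℂ) ^ 4
      - ((A x : Matrix (Fin n) (Fin n) ℝ) m j : ℂ) ^ 2) * hI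
  · push_cast
    linear_combination (((A x : Matrix (Fin n) (Fin n) ℝ) m j : ℂ) ^ 2
      * ((A x : Matrix (Fin n) (Fin n) ℝ) m k : ℂ) ^ 2) * hI

end FubiniStudy

/-! ### Slices transverse to the diagonal -/

section Slice

variable {k : ℕ}

/-- The inclusion `v ↦ (0, v)` of `ℝᵏ` into `ℝᵏ⁺¹`. -/
noncomputable def zeroCons (k : ℕ) : (Fin k → ℝ) →L[ℝ] (Fin (k + 1) → ℝ) :=
  ContinuousLinearMap.pi fun i =>
    Fin.cases (motive := fun _ => (Fin k → ℝ) →L[ℝ] ℝ) 0 (fun j => ContinuousLinearMap.proj j) i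

@[simp]
theorem zeroCons_apply_zero (v : Fin k → ℝ) : zeroCons k v 0 = 0 := rfl

@[simp]
theorem zeroCons_apply_succ (v : Fin k → ℝ) (j : Fin k) : zeroCons k v j.succ = v j := rfl

theorem zeroCons_single (a : Fin k) : zeroCons k (Pi.single a 1) = Pi.single a.succ 1 := by
  ext i
  refine Fin.cases ?_ (fun j => ?_) i
  · simp [(Fin.succ_ne_zero a).symm]
  · simp [Pi.single_apply]

/-- The quotient map `x ↦ (x_j - x_0)_{j ≥ 1}` of `ℝᵏ⁺¹` by the diagonal. -/
noncomputable def diagonalQuotient (k : ℕ) : (Fin (k + 1) → ℝ) →L[ℝ] (Fin k → ℝ) :=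
  ContinuousLinearMap.pi fun j =>
    ContinuousLinearMap.proj (R := ℝ) (φ := fun _ : Fin (k + 1) => ℝ) j.succ
      - ContinuousLinearMap.proj 0

@[simp]
theorem diagonalQuotient_apply (x : Fin (k + 1) → ℝ) (j : Fin k) :
    diagonalQuotient k x j = x j.succ - x 0 := rfl

/-- The section `v ↦ (0, v) + c𝟏` of `diagonalQuotient`, with image the hyperplane `x_0 = c`. -/
noncomputable def diagonalSection (c : ℝ) (v : Fin k → ℝ) : Fin (k + 1) → ℝ :=
  zeroCons k v + fun _ => c

theorem diagonalQuotient_diagonalSection (c : ℝ) (v : Fin k → ℝ) :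
    diagonalQuotient k (diagonalSection c v) = v := by
  ext j
  simp [diagonalSection]

theorem diagonalSection_diagonalQuotient (c : ℝ) (x : Fin (k + 1) → ℝ) :
    diagonalSection c (diagonalQuotient k x) = x + fun _ => c - x 0 := by
  ext i
  refine Fin.cases ?_ (fun j => ?_) i <;> simp [diagonalSection]
  ring

theorem contDiff_diagonalSection (c : ℝ) :
    ContDiff ℝ ∞ (diagonalSection c : (Fin k → ℝ) → Fin (k + 1) → ℝ) :=
  (zeroCons k).contDiff.add contDiff_const

theorem fderiv_comp_diagonalSection {E : Type*} [NormedAddCommGroup E] [NormedSpace ℝ E]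
    {f : (Fin (k + 1) → ℝ) → E} {c : ℝ} {v : Fin k → ℝ}
    (hf : DifferentiableAt ℝ f (diagonalSection c v)) (w : Fin k → ℝ) :
    fderiv ℝ (fun u => f (diagonalSection c u)) v w
      = fderiv ℝ f (diagonalSection c v) (zeroCons k w) := by
  have h1 : HasFDerivAt (diagonalSection c : (Fin k → ℝ) → Fin (k + 1) → ℝ) (zeroCons k) v :=
    (zeroCons k).hasFDerivAt.add_const _
  exact congrArg (fun L => L w) (hf.hasFDerivAt.comp v h1).fderiv

theorem pderiv_comp_diagonalSection {E : Type*} [NormedAddCommGroup E] [NormedSpace ℝ E]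
    {f : (Fin (k + 1) → ℝ) → E} {c : ℝ} {v : Fin k → ℝ}
    (hf : DifferentiableAt ℝ f (diagonalSection c v)) (a : Fin k) :
    pderiv (fun u => f (diagonalSection c u)) a v = pderiv f a.succ (diagonalSection c v) := by
  unfold pderiv
  rw [fderiv_comp_diagonalSection hf, zeroCons_single]

end Slice

/-! ### The flat Lagrangian immersion -/

section Immersion

variable {k : ℕ} {Ω : Set (Fin (k + 1) → ℝ)}
  {F : (Fin (k + 1) → ℝ) → Matrix (Fin (k + 1)) (Fin (k + 1)) ℝ}
  {A : (Fin (k + 1) → ℝ) → Matrix.orthogonalGroup (Fin (k + 1)) ℝ}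
  {U : (Fin (k + 1) → ℝ) → Matrix.unitaryGroup (Fin (k + 1)) ℂ}

/-- The coefficients of the forms `∑_b a_{mb} a_{lb} dx_b`, `l ≠ m`, restricted to a slice
transverse to the diagonal. -/
noncomputable def sliceCoframe (A : (Fin (k + 1) → ℝ) → Matrix.orthogonalGroup (Fin (k + 1)) ℝ)
    (m : Fin (k + 1)) (c : ℝ) (v : Fin k → ℝ) : Matrix (Fin k) (Fin k) ℝ :=
  Matrix.of fun l b =>
    (A (diagonalSection c v) : Matrix (Fin (k + 1)) (Fin (k + 1)) ℝ) m b.succ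
      * (A (diagonalSection c v) : Matrix (Fin (k + 1)) (Fin (k + 1)) ℝ) (m.succAbove l) b.succ

theorem sliceCoframe_transpose_mul_self (m : Fin (k + 1)) (c : ℝ) (v : Fin k → ℝ) (a b : Fin k) :
    ((sliceCoframe A m c v)ᵀ * sliceCoframe A m c v) a b
      = (if a = b then
          (A (diagonalSection c v) : Matrix (Fin (k + 1)) (Fin (k + 1)) ℝ) m a.succ ^ 2 else 0)
        - (A (diagonalSection c v) : Matrix (Fin (k + 1)) (Fin (k + 1)) ℝ) m a.succ ^ 2
          * (A (diagonalSection c v) : Matrix (Fin (k + 1)) (Fin (k + 1)) ℝ) m b.succ ^ 2 := by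
  have h := orthogonalGroup_sum_mul_column (A (diagonalSection c v)) a.succ b.succ
  rw [Fin.sum_univ_succAbove _ m] at h
  set B := (A (diagonalSection c v) : Matrix (Fin (k + 1)) (Fin (k + 1)) ℝ)
  have h2 : ((sliceCoframe A m c v)ᵀ * sliceCoframe A m c v) a b
      = B m a.succ * B m b.succ
        * ∑ l, B (m.succAbove l) a.succ * B (m.succAbove l) b.succ := by
    rw [Matrix.mul_apply, Finset.mul_sum]
    refine Finset.sum_congr rfl fun l _ => ?_
    simp only [sliceCoframe, Matrix.transpose_apply, Matrix.of_apply]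
    ring
  rw [h2, eq_sub_of_add_eq' h]
  by_cases hab : a = b
  · subst hab
    simp only [if_true]
    ring
  · rw [if_neg hab, if_neg (fun h => hab (Fin.succ_injective _ h))]
    ring

/-- If `J w = 0` then `(0, a_{mb} w_b)` is orthogonal to all rows of `A` except the `m`-th, hence
is a multiple of the `m`-th row; as `a_{m0} ≠ 0`, the multiple is zero. -/
theorem sliceCoframe_det_ne_zero {m : Fin (k + 1)} {c : ℝ} {v : Fin k → ℝ}
    (hne : ∀ j, (A (diagonalSection c v) : Matrix (Fin (k + 1)) (Fin (k + 1)) ℝ) m j ≠ 0) :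
    (sliceCoframe A m c v).det ≠ 0 := by
  intro hdet
  obtain ⟨w, hw0, hw⟩ := Matrix.exists_mulVec_eq_zero_iff.2 hdet
  have hrow := orthogonalGroup_sum_mul_column (A (diagonalSection c v))
  set B := (A (diagonalSection c v) : Matrix (Fin (k + 1)) (Fin (k + 1)) ℝ)
  set μ : ℝ := ∑ b : Fin k, B m b.succ * (B m b.succ * w b) with hμ
  -- `A (0, a_{mb} w_b) = μ e_m`; then `key` applies `Aᵗ`.
  have hl : ∀ l, ∑ b : Fin k, B l b.succ * (B m b.succ * w b) = if l = m then μ else 0 := by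
    intro l
    split_ifs with h
    · rw [h]
    · obtain ⟨r, rfl⟩ := Fin.exists_succAbove_eq h
      have := congrFun hw r
      rw [← Pi.zero_apply (M := fun _ : Fin k => ℝ) r, ← this, Matrix.mulVec, dotProduct]
      refine Finset.sum_congr rfl fun b _ => ?_
      simp only [sliceCoframe, Matrix.of_apply]
      ring
  have key : ∀ j, ∑ b : Fin k, (if j = b.succ then 1 else 0) * (B m b.succ * w b) = B m j * μ := by
    intro j
    have : ∑ l, B l j * ∑ b : Fin k, B l b.succ * (B m b.succ * w b) = B m j * μ := by
      simp [hl]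
    rw [← this]
    simp only [Finset.mul_sum]
    rw [Finset.sum_comm]
    refine Finset.sum_congr rfl fun b _ => ?_
    rw [← hrow j b.succ, Finset.sum_mul]
    exact Finset.sum_congr rfl fun l _ => by ring
  have hμ0 : μ = 0 := by
    have h := key 0
    simp only [(Fin.succ_ne_zero _).symm, if_false, zero_mul, Finset.sum_const_zero] at h
    exact (mul_eq_zero.1 h.symm).resolve_left (hne 0)
  refine hw0 (funext fun b => ?_)
  have h := key b.succ
  simp only [hμ0, mul_zero, Fin.succ_inj, ite_mul, one_mul, zero_mul, Finset.sum_ite_eq,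
    Finset.mem_univ, if_true] at h
  exact (mul_eq_zero.1 h).resolve_left (hne _)

/-- The forms `∑_b a_{mb} a_{lb} dx_b` are closed: for `a ≠ b`,
`∂_a (a_{mb} a_{lb}) = (a_{ma} a_{lb} + a_{mb} a_{la}) f_{ab}` is symmetric in `a` and `b`. -/
theorem pderiv_sliceCoframe_comm (hΩ : IsOpen Ω) (hF : IsUOSolution F Ω)
    (hA : IsOrthogonalFrame F A Ω) (m : Fin (k + 1)) {c : ℝ} {v : Fin k → ℝ}
    (hv : diagonalSection c v ∈ Ω) (l a b : Fin k) :
    pderiv (fun u => sliceCoframe A m c u l b) a v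
      = pderiv (fun u => sliceCoframe A m c u l a) b v := by
  by_cases hab : a = b
  · rw [hab]
  have hd : ∀ p q, DifferentiableAt ℝ
      (fun y => (A y : Matrix (Fin (k + 1)) (Fin (k + 1)) ℝ) p q) (diagonalSection c v) :=
    fun p q => ((hA.1 p q).contDiffAt (hΩ.mem_nhds hv)).differentiableAt (by simp)
  have h : ∀ a b : Fin k, a ≠ b → pderiv (fun u => sliceCoframe A m c u l b) a v
      = ((A (diagonalSection c v) : Matrix (Fin (k + 1)) (Fin (k + 1)) ℝ) m a.succ
          * (A (diagonalSection c v) : Matrix (Fin (k + 1)) (Fin (k + 1)) ℝ)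
              (m.succAbove l) b.succ
        + (A (diagonalSection c v) : Matrix (Fin (k + 1)) (Fin (k + 1)) ℝ) m b.succ
          * (A (diagonalSection c v) : Matrix (Fin (k + 1)) (Fin (k + 1)) ℝ)
              (m.succAbove l) a.succ)
        * F (diagonalSection c v) a.succ b.succ := by
    intro a b hab
    have hs : a.succ ≠ b.succ := fun h => hab (Fin.succ_injective _ h)
    change pderiv (fun u => (fun y => (A y : Matrix (Fin (k + 1)) (Fin (k + 1)) ℝ) m b.succ
      * (A y : Matrix (Fin (k + 1)) (Fin (k + 1)) ℝ) (m.succAbove l) b.succ)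
        (diagonalSection c u)) a v = _
    rw [pderiv_comp_diagonalSection ((hd _ _).fun_mul (hd _ _)), pderiv_mul (hd _ _) (hd _ _),
      hA.pderiv_entry_of_ne hv _ hs, hA.pderiv_entry_of_ne hv _ hs]
    ring
  rw [h a b hab, h b a (Ne.symm hab), hF.symm _ hv b.succ a.succ]
  ring

theorem IsUnitaryFrame.fderiv_slice_ne_smul (hΩ : IsOpen Ω) (hU : IsUnitaryFrame A U Ω)
    {m : Fin (k + 1)} {c : ℝ} {v : Fin k → ℝ} (hv : diagonalSection c v ∈ Ω)
    (hne : ∀ j, (A (diagonalSection c v) : Matrix (Fin (k + 1)) (Fin (k + 1)) ℝ) m j ≠ 0)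
    {w : Fin k → ℝ} (hw : w ≠ 0) (r : ℂ) :
    fderiv ℝ (fun u => (columnMap U m (diagonalSection c u) :
        EuclideanSpace ℂ (Fin (k + 1)))) v w
      ≠ r • (columnMap U m (diagonalSection c v) : EuclideanSpace ℂ (Fin (k + 1))) := by
  intro h
  rw [fderiv_comp_diagonalSection (f := fun y => (columnMap U m y :
    EuclideanSpace ℂ (Fin (k + 1)))) (hU.differentiableAt_columnMap hΩ m hv),
    fderiv_apply_eq_sum_pderiv] at h
  simp only [hU.pderiv_columnMap hΩ m hv] at h
  -- Comparing coefficients in the frame: the zeroth one forces `r = 0`, the others `w = 0`.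
  have hcoef : ∀ j, (zeroCons k w j : ℂ) * (Complex.I
      * ((A (diagonalSection c v) : Matrix (Fin (k + 1)) (Fin (k + 1)) ℝ) m j : ℂ))
      = r * ((A (diagonalSection c v) : Matrix (Fin (k + 1)) (Fin (k + 1)) ℝ) m j : ℂ) := by
    intro j
    have h' := congrArg (inner ℂ (frameVector A U j (diagonalSection c v))) h
    rw [inner_smul_right, inner_frameVector_columnMap, inner_sum] at h'
    rw [← h']
    simp [inner_smul_right, inner_frameVector, ← Complex.coe_smul]
  have hr : r = 0 := by
    have h0 := hcoef 0
    rw [zeroCons_apply_zero, Complex.ofReal_zero, zero_mul] at h0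
    exact (mul_eq_zero.1 h0.symm).resolve_right (Complex.ofReal_ne_zero.2 (hne 0))
  refine hw (funext fun b => ?_)
  have hb := hcoef b.succ
  rw [hr, zero_mul, zeroCons_apply_succ] at hb
  exact Complex.ofReal_eq_zero.1 ((mul_eq_zero.1 hb).resolve_right
    (mul_ne_zero Complex.I_ne_zero (Complex.ofReal_ne_zero.2 (hne _))))

theorem isFlatLagrangianImmersion_slice (hΩ : IsOpen Ω) (hF : IsUOSolution F Ω)
    (hA : IsOrthogonalFrame F A Ω) (hU : IsUnitaryFrame A U Ω) (m : Fin (k + 1)) (c : ℝ)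
    {V : Set (Fin k → ℝ)} (hV : IsOpen V) (hVΩ : ∀ v ∈ V, diagonalSection c v ∈ Ω)
    (hne : ∀ v ∈ V, ∀ j,
      (A (diagonalSection c v) : Matrix (Fin (k + 1)) (Fin (k + 1)) ℝ) m j ≠ 0) :
    IsFlatLagrangianImmersion (n := k + 1)
      (fun v => hopf (columnMap U m (diagonalSection c v))) V := by
  intro v hv
  have hp : ∀ u ∈ V, ∀ a : Fin k,
      pderiv (fun u => (columnMap U m (diagonalSection c u) : EuclideanSpace ℂ (Fin (k + 1)))) a u
        = _ := fun u hu a =>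
    (pderiv_comp_diagonalSection (f := fun y => (columnMap U m y :
      EuclideanSpace ℂ (Fin (k + 1)))) (hU.differentiableAt_columnMap hΩ m (hVΩ u hu)) a).trans
      (hU.pderiv_columnMap hΩ m (hVΩ u hu) a.succ)
  refine ⟨V, hV, hv, subset_rfl,
    fun u => (columnMap U m (diagonalSection c u) : EuclideanSpace ℂ (Fin (k + 1))),
    (hU.contDiffOn_columnMap m).comp (contDiff_diagonalSection c).contDiffOn hVΩ,
    fun u _ => ⟨ne_zero_of_mem_unit_sphere _, rfl⟩,
    fun u hu w hw r => hU.fderiv_slice_ne_smul hΩ (hVΩ u hu) (hne u hu) hw r,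
    fun u hu a b => ?_, ?_⟩
  -- The lift is presented with domain `Fin (k + 1 - 1) → ℝ`, which is `Fin k → ℝ` only up to
  -- unfolding.
  · erw [hp u hu a, hp u hu b]
    rw [fubiniStudy_frameVector, Complex.ofReal_im]
  · refine isFlatMetricOn_of_closed_coframe (d := k) (J := sliceCoframe A m c) hV
      (fun a b => ?_) (fun u hu => sliceCoframe_det_ne_zero (hne u hu))
      (fun u hu l a b => pderiv_sliceCoframe_comm hΩ hF hA m (hVΩ u hu) l a b) fun u hu => ?_
    · exact ((hA.1 _ _).comp (contDiff_diagonalSection c).contDiffOn hVΩ).mul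
        ((hA.1 _ _).comp (contDiff_diagonalSection c).contDiffOn hVΩ)
    · ext a b
      rw [sliceCoframe_transpose_mul_self]
      change (fubiniStudy _ (pderiv _ a u) (pderiv _ b u)).re = _
      erw [hp u hu a, hp u hu b]
      rw [fubiniStudy_frameVector, Complex.ofReal_re]
      simp [Fin.succ_inj]

/-- If `W` contains, with each point `x`, the diagonal segment from `x` to the hyperplane
`x_0 = c`, then `π ∘ X` factors on `W` through its slice by that hyperplane. -/
theorem imageIsFlatLagrangian_of_slice (hF : IsUOSolution F Ω)
    (hA : IsOrthogonalFrame F A Ω) (hU : IsUnitaryFrame A U Ω) (hΩ : IsOpen Ω)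
    (m : Fin (k + 1)) (c : ℝ) {W : Set (Fin (k + 1) → ℝ)} (hW : IsOpen W) (hWΩ : W ⊆ Ω)
    (hne : ∀ x ∈ W, ∀ j, (A x : Matrix (Fin (k + 1)) (Fin (k + 1)) ℝ) m j ≠ 0)
    (hseg : ∀ x ∈ W, ∀ s ∈ Set.uIcc 0 (c - x 0), (x + fun _ => s) ∈ W) :
    ImageIsFlatLagrangian (fun x => hopf (columnMap U m x)) W := by
  refine ⟨diagonalSection c ⁻¹' W, diagonalQuotient k,
    fun v => hopf (columnMap U m (diagonalSection c v)),
    hW.preimage (contDiff_diagonalSection c).continuous, (diagonalQuotient k).contDiff.contDiffOn,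
    fun x _ v => ⟨diagonalSection 0 v, ?_⟩, ?_,
    isFlatLagrangianImmersion_slice hΩ hF hA hU m c
      (hW.preimage (contDiff_diagonalSection c).continuous) (fun v hv => hWΩ hv)
      fun v hv => hne _ hv, fun x hx => ?_⟩
  · rw [(diagonalQuotient k).fderiv]
    exact diagonalQuotient_diagonalSection 0 v
  · ext v
    constructor
    · rintro ⟨x, hx, rfl⟩
      change diagonalSection c (diagonalQuotient k x) ∈ W
      rw [diagonalSection_diagonalQuotient]
      exact hseg x hx _ Set.right_mem_uIcc
    · exact fun hv => ⟨_, hv, diagonalQuotient_diagonalSection c v⟩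
  · change _ = hopf (columnMap U m (diagonalSection c (diagonalQuotient k x)))
    rw [diagonalSection_diagonalQuotient]
    exact (hU.hopf_columnMap_add_diagonal hΩ m fun s hs => hWΩ (hseg x hx s hs)).symm

end Immersion

/-- Each point of an open set has an open neighbourhood which contains, with each point, the
diagonal segment to the hyperplane `x_0 = c` through the given point. -/
theorem exists_open_diagonal_segments {k : ℕ} {O : Set (Fin (k + 1) → ℝ)} (hO : IsOpen O)
    {x : Fin (k + 1) → ℝ} (hx : x ∈ O) :
    ∃ W : Set (Fin (k + 1) → ℝ), IsOpen W ∧ x ∈ W ∧ W ⊆ O ∧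
      ∀ y ∈ W, ∀ s ∈ Set.uIcc 0 (x 0 - y 0), (y + fun _ => s) ∈ W := by
  obtain ⟨r, hr, hball⟩ := Metric.isOpen_iff.1 hO x hx
  refine ⟨Metric.ball x r ∩ (fun y => y + fun _ => x 0 - y 0) ⁻¹' Metric.ball x r,
    Metric.isOpen_ball.inter (Metric.isOpen_ball.preimage (by fun_prop)),
    ⟨Metric.mem_ball_self hr, ?_⟩, fun y hy => hball hy.1, fun y hy s hs => ⟨?_, ?_⟩⟩
  · have : (x + fun _ => x 0 - x 0) = x := by ext; simp
    simpa [this] using hr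
  · have hconv : Convex ℝ ((fun s : ℝ => y + fun _ : Fin (k + 1) => s) ⁻¹' Metric.ball x r) := by
      intro s hs t ht a b ha hb hab
      have h := convex_ball x r hs ht ha hb hab
      have he : y + (fun _ : Fin (k + 1) => a • s + b • t)
          = a • (y + fun _ => s) + b • (y + fun _ => t) := by
        ext i
        simp only [Pi.add_apply, Pi.smul_apply, smul_eq_mul]
        linear_combination -(y i) * hab
      change (y + fun _ : Fin (k + 1) => a • s + b • t) ∈ Metric.ball x r
      rw [he]
      exact h
    refine hconv.ordConnected.uIcc_subset ?_ hy.2 hs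
    have : (y + fun _ => (0 : ℝ)) = y := by ext; simp
    simpa [this] using hy.1
  · have : ((y + fun _ => s) + fun _ => x 0 - (y 0 + s)) = y + fun _ => x 0 - y 0 := by
      ext
      simp
      ring
    change ((y + fun _ => s) + fun _ => x 0 - (y 0 + s)) ∈ Metric.ball x r
    rw [this]
    exact hy.2

/-! ### Flat Lagrangian submanifolds of projective space -/

theorem proposition3p11 {n : ℕ} (Ω : Set (Fin n → ℝ)) (hΩ : IsOpen Ω)
    (F : (Fin n → ℝ) → Matrix (Fin n) (Fin n) ℝ) (hF : IsUOSolution F Ω)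
    (A : (Fin n → ℝ) → Matrix.orthogonalGroup (Fin n) ℝ) (hA : IsOrthogonalFrame F A Ω)
    (U : (Fin n → ℝ) → Matrix.unitaryGroup (Fin n) ℂ) (hU : IsUnitaryFrame A U Ω)
    (m : Fin n) :
    -- on a saturated domain the maximal choice of `O` is saturated
    (IsDiagonallySaturated Ω →
      IsDiagonallySaturated
        {x ∈ Ω | ∀ j, (A x : Matrix (Fin n) (Fin n) ℝ) m j ≠ 0}) ∧
    ∀ O : Set (Fin n → ℝ), IsOpen O → O ⊆ Ω →
      (∀ x ∈ O, ∀ j, (A x : Matrix (Fin n) (Fin n) ℝ) m j ≠ 0) →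
      -- the circle action is the flow of `∂/∂x_1 + ⋯ + ∂/∂x_n`
      (∀ x ∈ O, ∀ t : ℝ, (∀ s ∈ Set.uIcc 0 t, (x + fun _ => s) ∈ O) →
        (columnMap U m (x + fun _ => t) : EuclideanSpace ℂ (Fin n))
          = Complex.exp (t * Complex.I) • (columnMap U m x : EuclideanSpace ℂ (Fin n))) ∧
      -- `M = π⁻¹(π(M))`, and `π(M)` is a flat Lagrangian submanifold
      (IsDiagonallySaturated O →
        columnMap U m '' O = hopf ⁻¹' (hopf '' (columnMap U m '' O)) ∧
        ImageIsFlatLagrangian (fun x => hopf (columnMap U m x)) O) ∧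
      -- `π(M)` is a flat Lagrangian submanifold near each point, whether or not `O` is saturated
      (∀ x ∈ O, ∃ W : Set (Fin n → ℝ), IsOpen W ∧ x ∈ W ∧ W ⊆ O ∧
        ImageIsFlatLagrangian (fun y => hopf (columnMap U m y)) W) := by
  refine ⟨fun hsat x hx t => ⟨hsat x hx.1 t, fun j => ?_⟩, fun O hO hOΩ hne => ?_⟩
  · rw [hA.entry_add_diagonal hΩ fun s _ => hsat x hx.1 s]
    exact hx.2 j
  have hUO : IsUnitaryFrame A U O :=
    ⟨fun i j => (hU.1 i j).mono hOΩ, fun x hx => hU.2 x (hOΩ hx)⟩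
  refine ⟨fun x _ t ht => hUO.columnMap_add_diagonal hO m ht, fun hsat => ⟨?_, ?_⟩, fun x hx => ?_⟩
  · exact hUO.image_eq_hopf_preimage hO m hsat
  · cases n with
    | zero => exact m.elim0
    | succ k =>
      exact imageIsFlatLagrangian_of_slice hF hA hU hΩ m 0 hO hOΩ hne fun x hx s _ => hsat x hx s
  · cases n with
    | zero => exact m.elim0
    | succ k =>
      obtain ⟨W, hW, hxW, hWO, hseg⟩ := exists_open_diagonal_segments hO hx
      exact ⟨W, hW, hxW, hWO, imageIsFlatLagrangian_of_slice hF hA hU hΩ m (x 0) hW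
        (hWO.trans hOΩ) (fun y hy => hne y (hWO hy)) hseg⟩
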